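/- Let $n,m$ be integers with $m\ge 1$, and let $A\in\mathbb{C}^{n\times n}$, $B\in\mathbb{C}^{n\times m}$, $R\in\mathbb{C}^{m\times m}$ Hermitian positive definite and $H\in\mathbb{C}^{n\times n}$ Hermitian positive semidefinite. All inequalities between Hermitian matrices are in the Loewner order, $\overline X$ is the entrywise conjugate and $X^H$ the conjugate transpose. For a Hermitian $n\times n$ matrix $X$ put $R_X=R+B^H\overline XB$, let $\mathrm{dom}(\mathcal R)$ be the set of Hermitian $X$ with $\det R_X\neq0$, and for such $X$ put $$\mathcal R(X)=A^H\overline XA-A^H\overline XB\,R_X^{-1}B^H\overline XA+H .$$ Let $\mathbb R_\le,\mathbb R_=,\mathbb R_\ge$ be the sets of $X\in\mathrm{dom}(\mathcal R)$ with $X\le\mathcal R(X)$, $X=\mathcal R(X)$, $X\ge\mathcal R(X)$ respectively; let $\mathbb P$ and $\mathbb E$ be the sets of $X\in\mathrm{dom}(\mathcal R)$ with $R_X>0$ and $R_X<0$ respectively; let $\mathbb N_n$ be the set of $n\times n$ positive semidefinite matrices and $-\mathbb N_n$ its negative. For a set $S$ of Hermitian matrices, $\max S$ (resp. $\min S$)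 is the element of $S$ that is $\ge$ (resp. $\le$) every element of $S$, if there is one. Write $\mathbf{X_M}=\max(\mathbb R_=\cap\mathbb P)$, $\mathbf{X_m}=\min(\mathbb R_=\cap\mathbb P)$, $\mathbf{Y_M}=\max(\mathbb R_=\cap\mathbb E)$, $\mathbf{Y_m}=\min(\mathbb R_=\cap\mathbb E)$, $\mathbf{Z_M}=\max(\mathbb R_=\cap\mathbb N_n)$, $\mathbf{Z_m}=\min(\mathbb R_=\cap\mathbb N_n)$, $\mathbf{W_M}=\max(\mathbb R_=\cap-\mathbb N_n)$, $\mathbf{W_m}=\min(\mathbb R_=\cap-\mathbb N_n)$, whenever these exist. Then $\mathbb R_\le\cap\mathbb P\neq\emptyset$ and $\mathbb R_\ge\subseteq\mathbb P$. Moreover: 1. $\mathbf{Z_m}$ exists if $\mathbb R_\ge\cap\mathbb N_n\neq\emptyset$. 2. If $A$ is nonsingular, $\mathbf{W_M}$ exists if $\mathbb R_\ge\cap-\mathbb N_n\neq\emptyset$. 3. Suppose that $H>0$ and $A$ is nonsingular. If $\mathbb R_\ge\cap\mathbb N_n\neq\emptyset$, then $\mathbf{Z_m},\mathbf{Z_M},\mathbf{X_M}$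 exist and $0\le\mathbf{Z_m}\le\mathbf{Z_M}=\mathbf{X_M}$. If $\mathbb R_\ge\cap-\mathbb N_n\neq\emptyset$, then $\mathbf{X_m},\mathbf{W_m},\mathbf{W_M}$ exist and $\mathbf{X_m}=\mathbf{W_m}\le\mathbf{W_M}\le0$. Hence, if both sets are nonempty, all six exist and $$\mathbf{X_m}=\mathbf{W_m}\le\mathbf{W_M}\le0\le\mathbf{Z_m}\le\mathbf{Z_M}=\mathbf{X_M}.$$ In every case neither $\mathbf{Y_M}$ nor $\mathbf{Y_m}$ exists. -/

import Mathlib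

open scoped ComplexOrder MatrixOrder Matrix Pointwise

namespace CDARE

variable {n m : ℕ}

/-- The entrywise complex conjugate of a matrix. -/
def conjM {k l : ℕ} (X : Matrix (Fin k) (Fin l) ℂ) : Matrix (Fin k) (Fin l) ℂ :=
  X.map (starRingEnd ℂ)

/-- `R_X = R + Bᴴ X̄ B`. -/
def RX (B : Matrix (Fin n) (Fin m) ℂ) (R : Matrix (Fin m) (Fin m) ℂ)
    (X : Matrix (Fin n) (Fin n) ℂ) : Matrix (Fin m) (Fin m) ℂ :=
  R + Bᴴ * conjM X * B

/-- The conjugate Riccati operator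
`𝓡(X) = Aᴴ X̄ A - Aᴴ X̄ B R_X⁻¹ Bᴴ X̄ A + H`, meaningful on `dom B R`. -/
noncomputable def riccati (A : Matrix (Fin n) (Fin n) ℂ) (B : Matrix (Fin n) (Fin m) ℂ)
    (R : Matrix (Fin m) (Fin m) ℂ) (H X : Matrix (Fin n) (Fin n) ℂ) :
    Matrix (Fin n) (Fin n) ℂ :=
  Aᴴ * conjM X * A - Aᴴ * conjM X * B * (RX B R X)⁻¹ * Bᴴ * conjM X * A + H

/-- `dom(𝓡)`: the Hermitian matrices `X` such that `R_X` is nonsingular. -/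
def dom (B : Matrix (Fin n) (Fin m) ℂ) (R : Matrix (Fin m) (Fin m) ℂ) :
    Set (Matrix (Fin n) (Fin n) ℂ) :=
  {X | X.IsHermitian ∧ (RX B R X).det ≠ 0}

/-- `ℝ_≤ = {X ∈ dom(𝓡) | X ≤ 𝓡(X)}`, for the Loewner order. -/
def setLE (A : Matrix (Fin n) (Fin n) ℂ) (B : Matrix (Fin n) (Fin m) ℂ)
    (R : Matrix (Fin m) (Fin m) ℂ) (H : Matrix (Fin n) (Fin n) ℂ) :
    Set (Matrix (Fin n) (Fin n) ℂ) :=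
  {X | X ∈ dom B R ∧ X ≤ riccati A B R H X}

/-- `ℝ_≥ = {X ∈ dom(𝓡) | X ≥ 𝓡(X)}`, for the Loewner order. -/
def setGE (A : Matrix (Fin n) (Fin n) ℂ) (B : Matrix (Fin n) (Fin m) ℂ)
    (R : Matrix (Fin m) (Fin m) ℂ) (H : Matrix (Fin n) (Fin n) ℂ) :
    Set (Matrix (Fin n) (Fin n) ℂ) :=
  {X | X ∈ dom B R ∧ riccati A B R H X ≤ X}

/-- `ℝ_= = {X ∈ dom(𝓡) | X = 𝓡(X)}`, the Hermitian solutions of the equation. -/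
def setEQ (A : Matrix (Fin n) (Fin n) ℂ) (B : Matrix (Fin n) (Fin m) ℂ)
    (R : Matrix (Fin m) (Fin m) ℂ) (H : Matrix (Fin n) (Fin n) ℂ) :
    Set (Matrix (Fin n) (Fin n) ℂ) :=
  {X | X ∈ dom B R ∧ X = riccati A B R H X}

/-- `ℙ = {X ∈ dom(𝓡) | R_X > 0}`. -/
def setP (B : Matrix (Fin n) (Fin m) ℂ) (R : Matrix (Fin m) (Fin m) ℂ) :
    Set (Matrix (Fin n) (Fin n) ℂ) :=
  {X | X ∈ dom B R ∧ (RX B R X).PosDef}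

/-- `𝔼 = {X ∈ dom(𝓡) | R_X < 0}`. -/
def setE (B : Matrix (Fin n) (Fin m) ℂ) (R : Matrix (Fin m) (Fin m) ℂ) :
    Set (Matrix (Fin n) (Fin n) ℂ) :=
  {X | X ∈ dom B R ∧ (-RX B R X).PosDef}

/-- `ℕ_n`: the positive semidefinite matrices of size `n`; `-psd n` is its pointwise negative. -/
def psd (n : ℕ) : Set (Matrix (Fin n) (Fin n) ℂ) :=
  {X | X.PosSemidef}

end CDARE

/-! Write `𝓡(X) = Aᴴ F(X̄) A + H` with `F = schurMap B R`. Completing the square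
(`feedbackValue_eq_schurMap_add`) shows that, where `R + Bᴴ V B > 0`, `F(V)` is the minimum over
feedbacks `K` of a function affine and monotone in `V`. Hence `F` is monotone on the positive
semidefinite cone.

The inclusion `ℝ_≥ ⊆ ℙ` is an index argument. If `R_X` is nonsingular but not positive definite,
applying `F` turns a subspace on which the form is nonnegative into one of larger dimension. The
inequality `X ≥ 𝓡(X)` pulls this subspace back to `X̄`, so dimensions would grow without bound. All
solutions thus lie in `ℙ`, which is disjoint from `𝔼`.

Monotone iteration from `0` yields the least positive semidefinite solution. When `A` is invertible,
the inverse of `F` is `V ↦ -F(-V)`, so `-X` is a fixed point of an operator of the same monotone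
type, which handles the negative cone.

If `H > 0`, the closed loop at a semidefinite solution is a strict contraction in the order sense,
so that solution bounds all others (`nonpos_of_forall_le_smul_sub`). The extremal solutions in each
chain half therefore coincide. -/

namespace CDARE

/-! ### Entrywise conjugation and the Loewner order. -/

section Conjugation

variable {k l p : ℕ}

@[simp]
theorem conjM_conjM (X : Matrix (Fin k) (Fin l) ℂ) : conjM (conjM X) = X := by
  ext i j; simp [conjM]

@[simp]
theorem conjM_neg (X : Matrix (Fin k) (Fin l) ℂ) : conjM (-X) = -conjM X := by
  ext i j; simp [conjM]

@[simp]
theorem conjM_zero : conjM (0 : Matrix (Fin k) (Fin l) ℂ) = 0 := by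
  ext i j; simp [conjM]

theorem conjM_sub (X Y : Matrix (Fin k) (Fin l) ℂ) : conjM (X - Y) = conjM X - conjM Y := by
  ext i j; simp [conjM]

theorem conjM_real_smul (t : ℝ) (X : Matrix (Fin k) (Fin l) ℂ) :
    conjM (t • X) = t • conjM X := by
  ext i j; simp [conjM]

theorem continuous_conjM :
    Continuous (conjM : Matrix (Fin k) (Fin l) ℂ → Matrix (Fin k) (Fin l) ℂ) :=
  continuous_id.matrix_map Complex.continuous_conj

theorem posSemidef_conjM {X : Matrix (Fin k) (Fin k) ℂ} (hX : X.PosSemidef) :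
    (conjM X).PosSemidef :=
  hX.conjTranspose.transpose

theorem isHermitian_conjM {X : Matrix (Fin k) (Fin k) ℂ} (hX : X.IsHermitian) :
    (conjM X).IsHermitian :=
  hX.conjTranspose.transpose

theorem conjM_mono {X Y : Matrix (Fin k) (Fin k) ℂ} (h : X ≤ Y) : conjM X ≤ conjM Y := by
  rw [Matrix.le_iff, ← conjM_sub]
  exact posSemidef_conjM h

end Conjugation

/-! ### The Schur complement map: variational form, monotonicity, inverse. -/

section Schur

variable {n m : ℕ}

/-- The generalized Schur complement `V - V B (R + Bᴴ V B)⁻¹ Bᴴ V`. -/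
noncomputable def schurMap (B : Matrix (Fin n) (Fin m) ℂ) (R : Matrix (Fin m) (Fin m) ℂ)
    (V : Matrix (Fin n) (Fin n) ℂ) : Matrix (Fin n) (Fin n) ℂ :=
  V - V * B * (R + Bᴴ * V * B)⁻¹ * Bᴴ * V

/-- The closed-loop value of the feedback `K`. -/
def feedbackValue (B : Matrix (Fin n) (Fin m) ℂ) (R : Matrix (Fin m) (Fin m) ℂ)
    (K : Matrix (Fin m) (Fin n) ℂ) (V : Matrix (Fin n) (Fin n) ℂ) : Matrix (Fin n) (Fin n) ℂ :=
  (1 + B * K)ᴴ * V * (1 + B * K) + Kᴴ * R * K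

/-- The optimal feedback for `V`. -/
noncomputable def optFeedback (B : Matrix (Fin n) (Fin m) ℂ) (R : Matrix (Fin m) (Fin m) ℂ)
    (V : Matrix (Fin n) (Fin n) ℂ) : Matrix (Fin m) (Fin n) ℂ :=
  -((R + Bᴴ * V * B)⁻¹ * Bᴴ * V)

variable {A H V W : Matrix (Fin n) (Fin n) ℂ} {B : Matrix (Fin n) (Fin m) ℂ}
  {R : Matrix (Fin m) (Fin m) ℂ}

theorem riccati_eq_schurMap (A : Matrix (Fin n) (Fin n) ℂ) (B : Matrix (Fin n) (Fin m) ℂ)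
    (R : Matrix (Fin m) (Fin m) ℂ) (H X : Matrix (Fin n) (Fin n) ℂ) :
    riccati A B R H X = Aᴴ * schurMap B R (conjM X) * A + H := by
  simp only [riccati, schurMap, RX, Matrix.mul_sub, Matrix.sub_mul, Matrix.mul_assoc]

/-- Completion of the square in `K`. Only nonsingularity of `R + Bᴴ V B` is needed, so the identity
also serves the indefinite case of the index argument. -/
theorem feedbackValue_eq_schurMap_add (hV : V.IsHermitian) (hR : R.IsHermitian)
    (hdet : IsUnit (R + Bᴴ * V * B).det) (K : Matrix (Fin m) (Fin n) ℂ) :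
    feedbackValue B R K V = schurMap B R V +
      (K - optFeedback B R V)ᴴ * (R + Bᴴ * V * B) * (K - optFeedback B R V) := by
  set S := R + Bᴴ * V * B with hS
  have hSH : S.IsHermitian := hR.add (Matrix.isHermitian_conjTranspose_mul_mul B hV)
  have h1 : (K - optFeedback B R V)ᴴ = Kᴴ + V * B * S⁻¹ := by
    rw [optFeedback, ← hS]
    simp only [sub_neg_eq_add, Matrix.conjTranspose_add,
      Matrix.conjTranspose_mul, Matrix.conjTranspose_conjTranspose, hV.eq, hSH.inv.eq,
      Matrix.mul_assoc]
  have h2 : K - optFeedback B R V = K + S⁻¹ * (Bᴴ * V) := by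
    rw [optFeedback, ← hS]
    simp only [sub_neg_eq_add, Matrix.mul_assoc]
  have h3 : (Kᴴ + V * B * S⁻¹) * S = Kᴴ * S + V * B := by
    rw [Matrix.add_mul, Matrix.nonsing_inv_mul_cancel_right _ _ hdet]
  rw [h1, h2, h3, Matrix.mul_add, Matrix.add_mul, Matrix.add_mul, Matrix.mul_assoc Kᴴ S (S⁻¹ * _),
    Matrix.mul_nonsing_inv_cancel_left _ _ hdet]
  simp only [schurMap, ← hS]
  simp only [hS, feedbackValue, Matrix.conjTranspose_add, Matrix.conjTranspose_mul,
    Matrix.conjTranspose_one, Matrix.add_mul, Matrix.mul_add, Matrix.one_mul, Matrix.mul_one,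
    Matrix.mul_assoc]
  abel

theorem schurMap_le_feedbackValue (hV : V.IsHermitian) (hR : R.IsHermitian)
    (hpos : (R + Bᴴ * V * B).PosDef) (K : Matrix (Fin m) (Fin n) ℂ) :
    schurMap B R V ≤ feedbackValue B R K V := by
  rw [feedbackValue_eq_schurMap_add hV hR ((Matrix.isUnit_iff_isUnit_det _).1 hpos.isUnit)]
  exact le_add_of_nonneg_right
    (Matrix.nonneg_iff_posSemidef.2 (hpos.posSemidef.conjTranspose_mul_mul_same _))

theorem feedbackValue_optFeedback (hV : V.IsHermitian) (hR : R.IsHermitian)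
    (hpos : (R + Bᴴ * V * B).PosDef) :
    feedbackValue B R (optFeedback B R V) V = schurMap B R V := by
  rw [feedbackValue_eq_schurMap_add hV hR ((Matrix.isUnit_iff_isUnit_det _).1 hpos.isUnit)]
  simp

theorem conjTranspose_mul_mul_mono {k : ℕ} (C : Matrix (Fin n) (Fin k) ℂ) (h : V ≤ W) :
    Cᴴ * V * C ≤ Cᴴ * W * C := by
  rw [Matrix.le_iff, ← Matrix.sub_mul, ← Matrix.mul_sub]
  exact Matrix.PosSemidef.conjTranspose_mul_mul_same h C

theorem feedbackValue_mono (K : Matrix (Fin m) (Fin n) ℂ) (h : V ≤ W) :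
    feedbackValue B R K V ≤ feedbackValue B R K W :=
  add_le_add_left (conjTranspose_mul_mul_mono _ h) _

theorem feedbackValue_sub (K : Matrix (Fin m) (Fin n) ℂ) :
    feedbackValue B R K V - feedbackValue B R K W =
      (1 + B * K)ᴴ * (V - W) * (1 + B * K) := by
  simp only [feedbackValue, Matrix.mul_sub, Matrix.sub_mul, add_sub_add_right_eq_sub]

theorem posDef_add_of_posSemidef (hR : R.PosDef) (hV : V.PosSemidef) :
    (R + Bᴴ * V * B).PosDef :=
  hR.add_posSemidef (hV.conjTranspose_mul_mul_same B)

/-- The feedback optimal for `W` is merely admissible for `V`, and for a fixed feedback the value is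
monotone. -/
theorem schurMap_mono (hR : R.PosDef) (hV : V.PosSemidef) (h : V ≤ W) :
    schurMap B R V ≤ schurMap B R W := by
  have hW : W.PosSemidef :=
    Matrix.nonneg_iff_posSemidef.1 ((Matrix.nonneg_iff_posSemidef.2 hV).trans h)
  rw [← feedbackValue_optFeedback hW.isHermitian hR.isHermitian (posDef_add_of_posSemidef hR hW)]
  exact (schurMap_le_feedbackValue hV.isHermitian hR.isHermitian
    (posDef_add_of_posSemidef hR hV) _).trans (feedbackValue_mono _ h)

@[simp]
theorem schurMap_zero : schurMap B R 0 = 0 := by simp [schurMap]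

theorem posSemidef_schurMap (hR : R.PosDef) (hV : V.PosSemidef) : (schurMap B R V).PosSemidef := by
  rw [← Matrix.nonneg_iff_posSemidef]
  simpa using schurMap_mono (B := B) hR Matrix.PosSemidef.zero (Matrix.nonneg_iff_posSemidef.2 hV)

/-- With `S = R + Bᴴ V B`, this is the expansion of `(S - R) - (S - R) S⁻¹ (S - R) = R - R S⁻¹ R`.
-/
theorem sub_conj_schurMap_mul (hdet : IsUnit (R + Bᴴ * V * B).det) :
    (R - Bᴴ * schurMap B R V * B) = R * (R + Bᴴ * V * B)⁻¹ * R := by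
  set S := R + Bᴴ * V * B with hS
  have h1 : Bᴴ * schurMap B R V * B = (S - R) - (S - R) * S⁻¹ * (S - R) := by
    rw [show S - R = Bᴴ * V * B by rw [hS]; abel]
    rw [schurMap, ← hS]
    simp only [Matrix.mul_sub, Matrix.sub_mul, Matrix.mul_assoc]
  rw [h1]
  simp only [Matrix.mul_sub, Matrix.sub_mul, Matrix.mul_nonsing_inv _ hdet, Matrix.one_mul,
    Matrix.mul_assoc, Matrix.nonsing_inv_mul _ hdet, Matrix.mul_one]
  abel

/-- `V ↦ -schurMap (-V)` inverts `schurMap`. -/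
theorem neg_schurMap_neg_schurMap (hdet : IsUnit (R + Bᴴ * V * B).det) (hR : IsUnit R.det) :
    -schurMap B R (-schurMap B R V) = V := by
  have key := sub_conj_schurMap_mul (B := B) hdet
  set S := R + Bᴴ * V * B with hS
  set F := schurMap B R V with hF
  -- The weight attached to `-F` is `R S⁻¹ R` by `key`, so its inverse is explicit and the
  -- correction term collapses to `V B S⁻¹ Bᴴ V`.
  have hinv : (R + Bᴴ * (-F) * B)⁻¹ = R⁻¹ * S * R⁻¹ := by
    rw [show R + Bᴴ * (-F) * B = R * S⁻¹ * R by rw [← key]; simp [sub_eq_add_neg]]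
    rw [Matrix.mul_inv_rev, Matrix.mul_inv_rev, Matrix.nonsing_inv_nonsing_inv _ hdet,
      Matrix.mul_assoc]
  have h1 : F * B = V * B * S⁻¹ * R := by
    have : R = S - Bᴴ * V * B := by rw [hS]; abel
    conv_rhs => rw [this]
    rw [hF, schurMap, ← hS]
    simp only [Matrix.mul_sub, Matrix.sub_mul, Matrix.mul_assoc,
      Matrix.nonsing_inv_mul _ hdet, Matrix.mul_one]
  have h2 : F * B * (R⁻¹ * S * R⁻¹) = V * B * R⁻¹ := by
    rw [h1]
    simp only [Matrix.mul_assoc]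
    rw [Matrix.mul_nonsing_inv_cancel_left _ _ hR, Matrix.nonsing_inv_mul_cancel_left _ _ hdet]
  have h4 : V * B * R⁻¹ * Bᴴ * F = V * B * S⁻¹ * Bᴴ * V := by
    have h5 : Bᴴ * F = R * (S⁻¹ * (Bᴴ * V)) := by
      have : R = S - Bᴴ * V * B := by rw [hS]; abel
      conv_rhs => rw [this]
      rw [hF, schurMap, ← hS]
      simp only [Matrix.mul_sub, Matrix.sub_mul, Matrix.mul_assoc,
        Matrix.mul_nonsing_inv_cancel_left _ _ hdet]
    rw [Matrix.mul_assoc _ Bᴴ F, h5, Matrix.mul_assoc (V * B),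
      Matrix.nonsing_inv_mul_cancel_left _ _ hR]
    simp only [Matrix.mul_assoc]
  have h6 : schurMap B R (-F) = -F - F * B * (R⁻¹ * S * R⁻¹) * Bᴴ * F := by
    rw [schurMap, hinv]; simp
  rw [h6, h2, h4, hF, schurMap, ← hS]
  abel

theorem continuousAt_schurMap (hdet : (R + Bᴴ * V * B).det ≠ 0) :
    ContinuousAt (schurMap B R) V := by
  have h1 : ContinuousAt (fun V : Matrix (Fin n) (Fin n) ℂ => R + Bᴴ * V * B) V := by
    have : Continuous (fun V : Matrix (Fin n) (Fin n) ℂ => R + Bᴴ * V * B) := by fun_prop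
    exact this.continuousAt
  have h2 : ContinuousAt (fun V : Matrix (Fin n) (Fin n) ℂ => (R + Bᴴ * V * B)⁻¹) V := by
    refine ContinuousAt.comp (g := fun S : Matrix (Fin m) (Fin m) ℂ => S⁻¹) ?_ h1
    refine continuousAt_matrix_inv _ ?_
    simpa using continuousAt_inv₀ hdet
  have h3 : Continuous fun p : Matrix (Fin n) (Fin n) ℂ × Matrix (Fin m) (Fin m) ℂ =>
      p.1 - p.1 * B * p.2 * Bᴴ * p.1 := by fun_prop
  exact h3.continuousAt.comp (continuousAt_id.prodMk h2)

theorem continuousAt_schurMap_comp {E : Type*} [TopologicalSpace E]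
    {f : E → Matrix (Fin n) (Fin n) ℂ} {x : E} (hf : ContinuousAt f x)
    (hdet : (R + Bᴴ * f x * B).det ≠ 0) : ContinuousAt (fun y => schurMap B R (f y)) x :=
  (continuousAt_schurMap hdet).comp hf

end Schur

end CDARE

namespace CDARE

/-! ### Dimension count for nonnegative subspaces, giving `ℝ_≥ ⊆ ℙ`. -/

section Index

variable {n m : ℕ}

/-- The map `f` may be singular: the induced map `E ⧸ f⁻¹W → E ⧸ W` is injective all the same.
Scalars are real because complex conjugation is not complex linear. -/
theorem finrank_le_finrank_comap {E : Type*} [AddCommGroup E] [Module ℝ E] [FiniteDimensional ℝ E]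
    (f : E →ₗ[ℝ] E) (W : Submodule ℝ E) :
    Module.finrank ℝ W ≤ Module.finrank ℝ (W.comap f) := by
  have h : Module.finrank ℝ (E ⧸ W.comap f) ≤ Module.finrank ℝ (E ⧸ W) := by
    refine LinearMap.finrank_le_finrank_of_injective (f := Submodule.mapQ _ W f le_rfl) ?_
    rw [← LinearMap.ker_eq_bot, Submodule.mapQ, Submodule.ker_liftQ, LinearMap.ker_comp,
      Submodule.ker_mkQ, Submodule.mkQ_map_self]
  have h1 := (W.comap f).finrank_quotient_add_finrank
  have h2 := W.finrank_quotient_add_finrank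
  omega

theorem finrank_add_finrank_le_finrank_prod {E F : Type*} [AddCommGroup E] [Module ℝ E]
    [FiniteDimensional ℝ E] [AddCommGroup F] [Module ℝ F] [FiniteDimensional ℝ F]
    (p : Submodule ℝ E) (q : Submodule ℝ F) :
    Module.finrank ℝ p + Module.finrank ℝ q ≤ Module.finrank ℝ (p.prod q) := by
  rw [← Module.finrank_prod]
  refine LinearMap.finrank_le_finrank_of_injective
    (f := (p.subtype.prodMap q.subtype).codRestrict (p.prod q) fun x => ⟨x.1.2, x.2.2⟩) ?_
  rintro ⟨a, b⟩ ⟨c, d⟩ h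
  exact Prod.ext (Subtype.ext (congrArg (fun y => y.1.1) h))
    (Subtype.ext (congrArg (fun y => y.1.2) h))

/-- The Hermitian form `x ↦ Re (xᴴ M x)`. -/
def quadForm (M : Matrix (Fin n) (Fin n) ℂ) (x : Fin n → ℂ) : ℝ := (star x ⬝ᵥ M *ᵥ x).re

theorem quadForm_add (M N : Matrix (Fin n) (Fin n) ℂ) (x : Fin n → ℂ) :
    quadForm (M + N) x = quadForm M x + quadForm N x := by
  simp [quadForm, Matrix.add_mulVec]

theorem quadForm_conj {k : ℕ} (M : Matrix (Fin n) (Fin n) ℂ) (C : Matrix (Fin n) (Fin k) ℂ)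
    (x : Fin k → ℂ) : quadForm (Cᴴ * M * C) x = quadForm M (C *ᵥ x) := by
  simp only [quadForm, Matrix.star_mulVec, ← Matrix.mulVec_mulVec, Matrix.dotProduct_mulVec,
    Matrix.vecMul_vecMul]

theorem quadForm_smul (M : Matrix (Fin n) (Fin n) ℂ) (c : ℝ) (x : Fin n → ℂ) :
    quadForm M (c • x) = c ^ 2 * quadForm M x := by
  simp [quadForm, Matrix.mulVec_smul, sq, mul_assoc]

theorem quadForm_conjM (M : Matrix (Fin n) (Fin n) ℂ) (x : Fin n → ℂ) :
    quadForm (conjM M) x = quadForm M (star x) := by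
  simp only [quadForm, dotProduct, Matrix.mulVec, Complex.re_sum, conjM, Matrix.map_apply,
    Pi.star_apply, star_star]
  refine Finset.sum_congr rfl fun i _ => ?_
  rw [← Complex.conj_re, map_mul, map_sum]
  simp

theorem quadForm_nonneg {M : Matrix (Fin n) (Fin n) ℂ} (hM : M.PosSemidef) (x : Fin n → ℂ) :
    0 ≤ quadForm M x :=
  (Complex.le_def.1 (hM.dotProduct_mulVec_nonneg x)).1

theorem quadForm_pos {M : Matrix (Fin n) (Fin n) ℂ} (hM : M.PosDef) {x : Fin n → ℂ} (hx : x ≠ 0) :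
    0 < quadForm M x :=
  (Complex.lt_def.1 (hM.dotProduct_mulVec_pos hx)).1

theorem posDef_of_quadForm_pos {M : Matrix (Fin n) (Fin n) ℂ} (hM : M.IsHermitian)
    (h : ∀ x, x ≠ 0 → 0 < quadForm M x) : M.PosDef :=
  .of_dotProduct_mulVec_pos hM fun x hx =>
    Complex.lt_def.2 ⟨h x hx, (hM.im_star_dotProduct_mulVec_self x).symm⟩

/-- A rank-one `K` suffices; this turns the matrix identity for feedbacks into one for vectors. -/
theorem exists_mulVec_eq {x : Fin n → ℂ} (hx : x ≠ 0) (u : Fin m → ℂ) :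
    ∃ K : Matrix (Fin m) (Fin n) ℂ, K *ᵥ x = u := by
  have h : star x ⬝ᵥ x ≠ 0 := by simpa using hx
  refine ⟨Matrix.vecMulVec u ((star x ⬝ᵥ x)⁻¹ • star x), ?_⟩
  ext i
  simp [Matrix.smul_mulVec, Matrix.vecMulVec_mulVec, h]

theorem quadForm_completion {V : Matrix (Fin n) (Fin n) ℂ} {B : Matrix (Fin n) (Fin m) ℂ}
    {R : Matrix (Fin m) (Fin m) ℂ} (hV : V.IsHermitian) (hR : R.IsHermitian)
    (hdet : IsUnit (R + Bᴴ * V * B).det) {x : Fin n → ℂ} (hx : x ≠ 0) (u : Fin m → ℂ) :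
    quadForm V (x + B *ᵥ u) + quadForm R u = quadForm (schurMap B R V) x +
      quadForm (R + Bᴴ * V * B) (u - optFeedback B R V *ᵥ x) := by
  obtain ⟨K, rfl⟩ := exists_mulVec_eq hx u
  have h := congrArg (quadForm · x) (feedbackValue_eq_schurMap_add hV hR hdet K)
  simpa only [feedbackValue, quadForm_add _ _ x, quadForm_conj, Matrix.add_mulVec,
    Matrix.one_mulVec, Matrix.sub_mulVec, Matrix.mulVec_mulVec] using h

/-- If `R + Bᴴ V B` is nonsingular and not positive definite, passing from `V` to its Schur
complement strictly increases the dimension of the subspaces with nonnegative form. -/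
theorem exists_nonneg_subspace_schurMap {V : Matrix (Fin n) (Fin n) ℂ}
    {B : Matrix (Fin n) (Fin m) ℂ} {R : Matrix (Fin m) (Fin m) ℂ} (hV : V.IsHermitian)
    (hR : R.PosDef) (hdet : IsUnit (R + Bᴴ * V * B).det) (hS : ¬ (R + Bᴴ * V * B).PosDef)
    (N : Submodule ℝ (Fin n → ℂ)) (hN : ∀ x ∈ N, 0 ≤ quadForm V x) :
    ∃ N' : Submodule ℝ (Fin n → ℂ), (∀ x ∈ N', 0 ≤ quadForm (schurMap B R V) x) ∧
      Module.finrank ℝ N + 1 ≤ Module.finrank ℝ N' := by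
  set S := R + Bᴴ * V * B with hSdef
  obtain ⟨u₀, hu₀, hu₀S⟩ : ∃ u : Fin m → ℂ, u ≠ 0 ∧ quadForm S u ≤ 0 := by
    by_contra! h
    exact hS (posDef_of_quadForm_pos
      (hR.isHermitian.add (Matrix.isHermitian_conjTranspose_mul_mul B hV)) h)
  have hU : ∀ u ∈ Submodule.span ℝ {u₀}, quadForm S u ≤ 0 := by
    intro u hu
    obtain ⟨c, rfl⟩ := Submodule.mem_span_singleton.1 hu
    rw [quadForm_smul]
    exact mul_nonpos_of_nonneg_of_nonpos (sq_nonneg c) hu₀S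
  let fB : (Fin m → ℂ) →ₗ[ℝ] (Fin n → ℂ) := (Matrix.mulVecLin B).restrictScalars ℝ
  let fK : (Fin n → ℂ) →ₗ[ℝ] (Fin m → ℂ) :=
    (Matrix.mulVecLin (optFeedback B R V)).restrictScalars ℝ
  let E := (Fin m → ℂ) × (Fin n → ℂ)
  let Φ : E →ₗ[ℝ] E :=
    (LinearMap.fst ℝ _ _ - fK ∘ₗ LinearMap.snd ℝ _ _).prod
      (LinearMap.snd ℝ _ _ + fB ∘ₗ LinearMap.fst ℝ _ _)
  -- Pairs `(u, x)` with `u - K x` on the line through `u₀`, where `S ≤ 0`, and `x + B u ∈ N`, where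
  -- `V ≥ 0`. On them `quadForm_completion` makes the Schur form of `x` nonnegative.
  let T := ((Submodule.span ℝ {u₀}).prod N).comap Φ
  have hT : ∀ p ∈ T, quadForm S (p.1 - optFeedback B R V *ᵥ p.2) ≤ 0 ∧
      0 ≤ quadForm V (p.2 + B *ᵥ p.1) := fun p hp => ⟨hU _ hp.1, hN _ hp.2⟩
  have hTrank : Module.finrank ℝ N + 1 ≤ Module.finrank ℝ T := by
    rw [add_comm, ← finrank_span_singleton (K := ℝ) hu₀]
    exact (finrank_add_finrank_le_finrank_prod _ N).trans (finrank_le_finrank_comap Φ _)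
  let g : T →ₗ[ℝ] (Fin n → ℂ) := LinearMap.snd ℝ _ _ ∘ₗ T.subtype
  -- If `x = 0`, then `S(u) ≤ 0` while `S(u) = R(u) + V(B u)` with `V(B u) ≥ 0`, forcing `u = 0`. So
  -- projecting to `x` loses no dimension.
  have hg : Function.Injective g := by
    rw [← LinearMap.ker_eq_bot, LinearMap.ker_eq_bot']
    rintro ⟨⟨u, x⟩, hp⟩ (rfl : x = 0)
    have hp' := hT _ hp
    simp only [Matrix.mulVec_zero, sub_zero, zero_add] at hp'
    have hu : u = 0 := by
      by_contra hu
      have h1 := quadForm_pos hR hu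
      rw [hSdef, quadForm_add, quadForm_conj] at hp'
      linarith [hp'.1, hp'.2]
    subst hu
    rfl
  refine ⟨LinearMap.range g, ?_, by rwa [LinearMap.finrank_range_of_inj hg]⟩
  rintro _ ⟨⟨⟨u, x⟩, hp⟩, rfl⟩
  change 0 ≤ quadForm _ x
  by_cases hx : x = 0
  · simp [hx, quadForm]
  · have h1 := quadForm_completion hV hR.isHermitian hdet hx u
    have h2 := hT _ hp
    have h3 := quadForm_nonneg hR.posSemidef u
    simp only [← hSdef] at h1 h2
    linarith [h2.1, h2.2]

theorem setGE_subset_setP (A : Matrix (Fin n) (Fin n) ℂ) (B : Matrix (Fin n) (Fin m) ℂ)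
    {R : Matrix (Fin m) (Fin m) ℂ} {H : Matrix (Fin n) (Fin n) ℂ} (hR : R.PosDef)
    (hH : H.PosSemidef) : setGE A B R H ⊆ setP B R := by
  rintro X ⟨⟨hX, hdet⟩, hge⟩
  refine ⟨⟨hX, hdet⟩, ?_⟩
  by_contra hS
  let fA : (Fin n → ℂ) →ₗ[ℝ] (Fin n → ℂ) := (Matrix.mulVecLin A).restrictScalars ℝ
  let σ : (Fin n → ℂ) →ₗ[ℝ] (Fin n → ℂ) :=
    LinearMap.pi fun i => Complex.conjAe.toLinearMap ∘ₗ LinearMap.proj i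
  have hσ : ∀ x, σ x = star x := fun x => rfl
  have key : ∀ k : ℕ, ∃ N : Submodule ℝ (Fin n → ℂ),
      (∀ x ∈ N, 0 ≤ quadForm (conjM X) x) ∧ k ≤ Module.finrank ℝ N := by
    intro k
    induction k with
    | zero => exact ⟨⊥, by simp [quadForm], Nat.zero_le _⟩
    | succ k ih =>
      obtain ⟨N, hN, hk⟩ := ih
      obtain ⟨N', hN', hk'⟩ := exists_nonneg_subspace_schurMap (isHermitian_conjM hX) hR
        (isUnit_iff_ne_zero.2 hdet) hS N hN
      -- The form of `X̄` at `x` is that of `X` at `star x`, which dominates the Schur form at `A *ᵥ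
      -- star x`.
      refine ⟨(N'.comap fA).comap σ, fun x hx => ?_, ?_⟩
      · have h1 := quadForm_nonneg (Matrix.le_iff.1 hge) (star x)
        have h2 := hN' _ hx
        have h3 := quadForm_nonneg hH (star x)
        have h4 : X = (X - riccati A B R H X) +
            (Aᴴ * schurMap B R (conjM X) * A + H) := by
          rw [← riccati_eq_schurMap]; abel
        rw [quadForm_conjM, h4, quadForm_add, quadForm_add, quadForm_conj]
        change 0 ≤ quadForm _ (A *ᵥ star x) at h2
        linarith
      · exact ((Nat.add_le_add_right hk 1).trans hk').trans
          ((finrank_le_finrank_comap fA N').trans (finrank_le_finrank_comap σ _))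
  obtain ⟨N, -, hN⟩ := key (Module.finrank ℝ (Fin n → ℂ) + 1)
  have := N.finrank_le
  omega

theorem disjoint_setP_setE (hm : 0 < m) (B : Matrix (Fin n) (Fin m) ℂ)
    (R : Matrix (Fin m) (Fin m) ℂ) : Disjoint (setP B R) (setE B R) := by
  rw [Set.disjoint_left]
  rintro X ⟨-, h1⟩ ⟨-, h2⟩
  have h3 := h1.diag_pos (i := ⟨0, hm⟩)
  have h4 := h2.diag_pos (i := ⟨0, hm⟩)
  rw [Matrix.neg_apply] at h4
  exact lt_asymm h3 (neg_pos.1 h4)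

end Index

end CDARE

namespace CDARE

/-! ### Monotone iteration and an order-theoretic contraction principle. -/

section Iteration

open scoped Matrix.Norms.L2Operator
open Filter Topology

variable {n : ℕ}

/-- A continuous monotone self-map of the positive semidefinite cone with a point `Φ X ≤ X`
has a fixed point below all such points. -/
theorem exists_least_fixedPoint (Φ : Matrix (Fin n) (Fin n) ℂ → Matrix (Fin n) (Fin n) ℂ)
    (hmono : ∀ V W, 0 ≤ V → V ≤ W → Φ V ≤ Φ W) (hpos : ∀ V, 0 ≤ V → 0 ≤ Φ V)
    (hcont : ∀ V, 0 ≤ V → ContinuousAt Φ V) {X₀ : Matrix (Fin n) (Fin n) ℂ} (hX₀ : 0 ≤ X₀)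
    (hΦX₀ : Φ X₀ ≤ X₀) :
    ∃ L, 0 ≤ L ∧ Φ L = L ∧ ∀ Y, 0 ≤ Y → Φ Y ≤ Y → L ≤ Y := by
  let x : ℕ → Matrix (Fin n) (Fin n) ℂ := fun k => Φ^[k] 0
  have hx_succ : ∀ k, x (k + 1) = Φ (x k) := fun k => Function.iterate_succ_apply' _ _ _
  have hx_nonneg : ∀ k, 0 ≤ x k := by
    intro k
    induction k with
    | zero => exact le_rfl
    | succ k ih => rw [hx_succ]; exact hpos _ ih
  have hx_step : ∀ k, x k ≤ x (k + 1) := by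
    intro k
    induction k with
    | zero => exact hx_nonneg 1
    | succ k ih => rw [hx_succ, hx_succ (k + 1)]; exact hmono _ _ (hx_nonneg k) ih
  have hx_mono : Monotone x := monotone_nat_of_le_succ hx_step
  have hx_le : ∀ Y, 0 ≤ Y → Φ Y ≤ Y → ∀ k, x k ≤ Y := by
    intro Y hY hΦY k
    induction k with
    | zero => exact hY
    | succ k ih => rw [hx_succ]; exact (hmono _ _ (hx_nonneg k) ih).trans hΦY
  -- The C⋆-norm is monotone on the positive cone, so `X₀` bounds the iterates; monotonicity makes a
  -- subsequential limit an upper bound of the whole sequence.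
  obtain ⟨L, -, φ, hφ, hL⟩ := tendsto_subseq_of_bounded
    (Metric.isBounded_closedBall (x := (0 : Matrix (Fin n) (Fin n) ℂ)) (r := ‖X₀‖)) (x := x)
    fun k => mem_closedBall_zero_iff.2
      (CStarAlgebra.norm_le_norm_of_nonneg_of_le (hx_nonneg k) (hx_le X₀ hX₀ hΦX₀ k))
  have hL_nonneg : 0 ≤ L := ge_of_tendsto' hL fun k => hx_nonneg _
  have hx_le_L : ∀ k, x k ≤ L := fun k =>
    ge_of_tendsto hL (eventually_atTop.2 ⟨k, fun j hj => hx_mono (hj.trans (hφ.id_le j))⟩)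
  have hΦL : Tendsto (fun k => x (φ k + 1)) atTop (𝓝 (Φ L)) := by
    simp only [hx_succ]
    exact (hcont L hL_nonneg).tendsto.comp hL
  refine ⟨L, hL_nonneg, le_antisymm (le_of_tendsto' hΦL fun k => hx_le_L _)
    (le_of_tendsto_of_tendsto' hL hΦL fun k => hx_step _), fun Y hY hΦY =>
    le_of_tendsto' hL fun k => hx_le Y hY hΦY _⟩

theorem exists_le_smul_posDef {H : Matrix (Fin n) (Fin n) ℂ} (hH : H.PosDef)
    {D : Matrix (Fin n) (Fin n) ℂ} (hD : D.IsHermitian) : ∃ c : ℝ, 0 < c ∧ D ≤ c • H := by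
  obtain hn | hn := subsingleton_or_nontrivial (Matrix (Fin n) (Fin n) ℂ)
  · exact ⟨1, one_pos, (Subsingleton.elim _ _).le⟩
  obtain ⟨r, hr, hrH⟩ := (CFC.exists_pos_algebraMap_le_iff
    (hH.isHermitian.isSelfAdjoint)).2 fun x hx =>
      (Matrix.isStrictlyPositive_iff_posDef.2 hH).spectrum_pos hx
  refine ⟨(‖D‖ + 1) / r, by positivity, ?_⟩
  calc D ≤ algebraMap ℝ _ ‖D‖ := IsSelfAdjoint.le_algebraMap_norm_self hD
    _ ≤ algebraMap ℝ _ (‖D‖ + 1) := algebraMap_mono _ (by linarith)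
    _ = ((‖D‖ + 1) / r) • algebraMap ℝ (Matrix (Fin n) (Fin n) ℂ) r := by
      rw [Algebra.algebraMap_eq_smul_one, Algebra.algebraMap_eq_smul_one, smul_smul,
        div_mul_cancel₀ _ hr.ne']
    _ ≤ ((‖D‖ + 1) / r) • H := smul_le_smul_of_nonneg_left hrH (by positivity)

/-- From `Q ≤ c • H` with `c ≥ 1` follows `Q - H ≤ (1 - c⁻¹) • Q`, so each use of `hstep` shrinks
the bound on `D` by a factor below `1`. The bounds tend to `0`. -/
theorem nonpos_of_forall_le_smul_sub {H Q D : Matrix (Fin n) (Fin n) ℂ} (hH : H.PosDef)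
    (hHQ : H ≤ Q) (hD : D.IsHermitian)
    (hstep : ∀ t : ℝ, 0 ≤ t → D ≤ t • Q → D ≤ t • (Q - H)) : D ≤ 0 := by
  have hQ : 0 ≤ Q := (Matrix.nonneg_iff_posSemidef.2 hH.posSemidef).trans hHQ
  obtain ⟨a, ha, haQ⟩ := exists_le_smul_posDef hH (Matrix.nonneg_iff_posSemidef.1 hQ).isHermitian
  obtain ⟨b, hb, hbD⟩ := exists_le_smul_posDef hH hD
  set c := max a 1
  have hc : 1 ≤ c := le_max_right _ _
  have hc0 : 0 < c := by linarith
  have hcQ : Q ≤ c • H := haQ.trans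
    (smul_le_smul_of_nonneg_right (le_max_left _ _) (Matrix.nonneg_iff_posSemidef.2 hH.posSemidef))
  have hρ0 : 0 ≤ 1 - c⁻¹ := sub_nonneg.2 (inv_le_one_of_one_le₀ hc)
  have hρ : Q - H ≤ (1 - c⁻¹) • Q := by
    rw [sub_smul, one_smul]
    refine sub_le_sub_left ?_ _
    simpa [smul_smul, inv_mul_cancel₀ hc0.ne'] using
      smul_le_smul_of_nonneg_left hcQ (inv_nonneg.2 hc0.le)
  have hpow : ∀ k : ℕ, D ≤ (b * (1 - c⁻¹) ^ k) • Q := by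
    intro k
    induction k with
    | zero => simpa using hbD.trans (smul_le_smul_of_nonneg_left hHQ hb.le)
    | succ k ih =>
      have hk : 0 ≤ b * (1 - c⁻¹) ^ k := by positivity
      refine (hstep _ hk ih).trans ((smul_le_smul_of_nonneg_left hρ hk).trans_eq ?_)
      rw [smul_smul, pow_succ, mul_assoc]
  have hlim : Tendsto (fun k : ℕ => (b * (1 - c⁻¹) ^ k) • Q) atTop (𝓝 0) := by
    have h1 := (tendsto_pow_atTop_nhds_zero_of_lt_one hρ0
      (sub_lt_self 1 (inv_pos.2 hc0))).const_mul b
    simpa using h1.smul_const Q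
  exact ge_of_tendsto' hlim hpow

end Iteration

/-! ### Positive semidefinite solutions. -/

section Solutions

variable {n m : ℕ} {A H : Matrix (Fin n) (Fin n) ℂ} {B : Matrix (Fin n) (Fin m) ℂ}
  {R : Matrix (Fin m) (Fin m) ℂ}

theorem mem_setP_of_posSemidef (hR : R.PosDef) {X : Matrix (Fin n) (Fin n) ℂ}
    (hX : X.PosSemidef) : X ∈ setP B R := by
  have h : (RX B R X).PosDef := posDef_add_of_posSemidef hR (posSemidef_conjM hX)
  exact ⟨⟨hX.isHermitian, ((Matrix.isUnit_iff_isUnit_det _).1 h.isUnit).ne_zero⟩, h⟩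

/-- `L` is the closed loop of the feedback optimal for `V`: it is suboptimal for `U`, and dropping
the cost `Kᴴ R K` gives the second bound. -/
theorem exists_contraction {U V : Matrix (Fin n) (Fin n) ℂ} (hR : R.PosDef) (hU : U.IsHermitian)
    (hV : V.IsHermitian) (hRU : (R + Bᴴ * U * B).PosDef) (hRV : (R + Bᴴ * V * B).PosDef) :
    ∃ L : Matrix (Fin n) (Fin n) ℂ, schurMap B R U - schurMap B R V ≤ Lᴴ * (U - V) * L ∧
      Lᴴ * V * L ≤ schurMap B R V := by
  refine ⟨1 + B * optFeedback B R V, ?_, ?_⟩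
  · rw [← feedbackValue_sub, feedbackValue_optFeedback hV hR.isHermitian hRV]
    exact sub_le_sub_right (schurMap_le_feedbackValue hU hR.isHermitian hRU _) _
  · rw [← feedbackValue_optFeedback hV hR.isHermitian hRV]
    exact le_add_of_nonneg_right
      (Matrix.nonneg_iff_posSemidef.2 (hR.posSemidef.conjTranspose_mul_mul_same _))

theorem exists_isLeast_setEQ_psd (hR : R.PosDef) (hH : H.PosSemidef)
    (hne : (setGE A B R H ∩ psd n).Nonempty) :
    ∃ Z, IsLeast (setEQ A B R H ∩ psd n) Z := by
  obtain ⟨X₀, ⟨-, hX₀ge⟩, hX₀⟩ := hne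
  have hmono : ∀ V W : Matrix (Fin n) (Fin n) ℂ, 0 ≤ V → V ≤ W →
      riccati A B R H V ≤ riccati A B R H W := by
    intro V W hV hVW
    rw [riccati_eq_schurMap, riccati_eq_schurMap]
    exact add_le_add_left (conjTranspose_mul_mul_mono _ (schurMap_mono hR
      (posSemidef_conjM (Matrix.nonneg_iff_posSemidef.1 hV)) (conjM_mono hVW))) _
  have hzero : 0 ≤ riccati A B R H 0 := by
    simpa [riccati_eq_schurMap] using Matrix.nonneg_iff_posSemidef.2 hH
  obtain ⟨L, hL, hfix, hleast⟩ := exists_least_fixedPoint (riccati A B R H) hmono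
    (fun V hV => hzero.trans (hmono 0 V le_rfl hV)) (fun V hV => by
      have h1 : ContinuousAt (fun X => schurMap B R (conjM X)) V :=
        continuousAt_schurMap_comp continuous_conjM.continuousAt
          (mem_setP_of_posSemidef hR (Matrix.nonneg_iff_posSemidef.1 hV)).1.2
      have h2 : Continuous fun F : Matrix (Fin n) (Fin n) ℂ => Aᴴ * F * A + H := by fun_prop
      rw [show riccati A B R H = _ from funext (riccati_eq_schurMap A B R H)]
      exact h2.continuousAt.comp h1)
    (Matrix.nonneg_iff_posSemidef.2 hX₀) hX₀ge
  have hL' := Matrix.nonneg_iff_posSemidef.1 hL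
  exact ⟨L, ⟨⟨(mem_setP_of_posSemidef hR hL').1, hfix.symm⟩, hL'⟩, fun Y hY =>
    hleast Y (Matrix.nonneg_iff_posSemidef.2 hY.2) hY.1.2.symm.le⟩

/-- When `H > 0`, a positive semidefinite solution dominates every solution in `ℙ`. -/
theorem le_of_mem_setEQ_psd (hR : R.PosDef) (hH : H.PosDef) {X Z : Matrix (Fin n) (Fin n) ℂ}
    (hZ : Z ∈ setEQ A B R H ∩ psd n) (hX : X ∈ setEQ A B R H ∩ setP B R) : X ≤ Z := by
  obtain ⟨⟨-, hZeq⟩, hZpos⟩ := hZ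
  obtain ⟨⟨⟨hXH, -⟩, hXeq⟩, -, hXP⟩ := hX
  change Z.PosSemidef at hZpos
  obtain ⟨L, hL1, hL2⟩ := exists_contraction hR (isHermitian_conjM hXH)
    (isHermitian_conjM hZpos.isHermitian) hXP (mem_setP_of_posSemidef hR hZpos).2
  rw [riccati_eq_schurMap] at hXeq hZeq
  -- The positive map `T(D) = Aᴴ Lᴴ D̄ L A` satisfies `T(Z) ≤ Z - H` and `X - Z ≤ T(X - Z)`, so the
  -- contraction principle applies with `Q = Z`.
  have hLZ : Aᴴ * (Lᴴ * conjM Z * L) * A ≤ Z - H := by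
    rw [le_sub_iff_add_le]
    exact (add_le_add_left (conjTranspose_mul_mul_mono A hL2) H).trans hZeq.symm.le
  have hLX : X - Z ≤ Aᴴ * (Lᴴ * conjM (X - Z) * L) * A := by
    rw [conjM_sub]
    refine le_trans (le_of_eq ?_) (conjTranspose_mul_mul_mono A hL1)
    rw [Matrix.mul_sub, Matrix.sub_mul]
    nth_rw 1 [hXeq, hZeq]
    abel
  refine sub_nonpos.1 (nonpos_of_forall_le_smul_sub hH (Q := Z) ?_
    (hXH.sub hZpos.isHermitian) fun t ht hD => ?_)
  · rw [hZeq]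
    exact le_add_of_nonneg_left (Matrix.nonneg_iff_posSemidef.2
      ((posSemidef_schurMap hR (posSemidef_conjM hZpos)).conjTranspose_mul_mul_same A))
  · refine hLX.trans ((conjTranspose_mul_mul_mono A (conjTranspose_mul_mul_mono L
      (conjM_mono hD))).trans ?_)
    rw [conjM_real_smul]
    simpa only [Matrix.mul_smul, Matrix.smul_mul] using smul_le_smul_of_nonneg_left hLZ ht

end Solutions

/-! ### Negative semidefinite solutions through the inverse operator. -/

section Dual

variable {n m : ℕ}

/-- The operator whose fixed points are the negatives of the solutions: `Y ↦ -𝓡⁻¹(-Y)`. -/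
noncomputable def dualRiccati (A : Matrix (Fin n) (Fin n) ℂ) (B : Matrix (Fin n) (Fin m) ℂ)
    (R : Matrix (Fin m) (Fin m) ℂ) (H Y : Matrix (Fin n) (Fin n) ℂ) : Matrix (Fin n) (Fin n) ℂ :=
  conjM (schurMap B R ((A⁻¹)ᴴ * (Y + H) * A⁻¹))

variable {A H V X Y : Matrix (Fin n) (Fin n) ℂ} {B : Matrix (Fin n) (Fin m) ℂ}
  {R : Matrix (Fin m) (Fin m) ℂ}

theorem posDef_add_neg_schurMap (hR : R.PosDef) (hS : (R + Bᴴ * V * B).PosDef) :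
    (R + Bᴴ * (-schurMap B R V) * B).PosDef := by
  have h := sub_conj_schurMap_mul (B := B) (V := V) ((Matrix.isUnit_iff_isUnit_det _).1 hS.isUnit)
  rw [show R + Bᴴ * (-schurMap B R V) * B = R - Bᴴ * schurMap B R V * B by
    simp [sub_eq_add_neg], h]
  have h2 := hS.inv.conjTranspose_mul_mul_same
    (Matrix.mulVec_injective_iff_isUnit.2 hR.isUnit)
  rwa [hR.isHermitian.eq] at h2

theorem inv_conj_sub_riccati (hA : A.det ≠ 0) (X : Matrix (Fin n) (Fin n) ℂ) :
    (A⁻¹)ᴴ * (-riccati A B R H X + H) * A⁻¹ = -schurMap B R (conjM X) := by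
  have hA' : IsUnit A.det := isUnit_iff_ne_zero.2 hA
  have hAH : (A⁻¹)ᴴ * Aᴴ = 1 := by
    rw [← Matrix.conjTranspose_mul, Matrix.mul_nonsing_inv _ hA', Matrix.conjTranspose_one]
  rw [riccati_eq_schurMap, neg_add_rev, neg_add_cancel_comm]
  rw [Matrix.mul_neg, Matrix.neg_mul, Matrix.mul_assoc Aᴴ, ← Matrix.mul_assoc _ Aᴴ, hAH,
    Matrix.one_mul, Matrix.mul_nonsing_inv_cancel_right _ _ hA']

theorem dualRiccati_neg_riccati (hR : R.PosDef) (hA : A.det ≠ 0) (hX : X ∈ setP B R) :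
    dualRiccati A B R H (-riccati A B R H X) = -X := by
  have h := neg_schurMap_neg_schurMap (B := B) (V := conjM X)
    (isUnit_iff_ne_zero.2 hX.1.2) ((Matrix.isUnit_iff_isUnit_det _).1 hR.isUnit)
  rw [dualRiccati, inv_conj_sub_riccati hA, ← neg_inj, ← conjM_neg, h, conjM_conjM, neg_neg]

theorem posSemidef_inv_conj (hH : H.PosSemidef) (hY : Y.PosSemidef) :
    ((A⁻¹)ᴴ * (Y + H) * A⁻¹).PosSemidef :=
  (hY.add hH).conjTranspose_mul_mul_same _

theorem mem_setEQ_of_dualRiccati_eq (hR : R.PosDef) (hH : H.PosSemidef) (hA : A.det ≠ 0)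
    (hY : Y.PosSemidef) (hfix : dualRiccati A B R H Y = Y) :
    -Y ∈ setEQ A B R H ∩ setP B R := by
  have hA' : IsUnit A.det := isUnit_iff_ne_zero.2 hA
  have hS := posDef_add_of_posSemidef (B := B) hR (posSemidef_inv_conj (A := A) hH hY)
  have hconj : conjM (-Y) = -schurMap B R ((A⁻¹)ᴴ * (Y + H) * A⁻¹) := by
    rw [conjM_neg, ← hfix, dualRiccati, conjM_conjM, ← dualRiccati, hfix]
  have hP : (RX B R (-Y)).PosDef := by
    rw [RX, hconj]
    exact posDef_add_neg_schurMap hR hS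
  have hdom : -Y ∈ dom B R :=
    ⟨hY.isHermitian.neg, ((Matrix.isUnit_iff_isUnit_det _).1 hP.isUnit).ne_zero⟩
  refine ⟨⟨hdom, ?_⟩, hdom, hP⟩
  have hAH : Aᴴ * (A⁻¹)ᴴ = 1 := by
    rw [← Matrix.conjTranspose_mul, Matrix.nonsing_inv_mul _ hA', Matrix.conjTranspose_one]
  rw [riccati_eq_schurMap, hconj, neg_eq_iff_eq_neg.1 (neg_schurMap_neg_schurMap
    ((Matrix.isUnit_iff_isUnit_det _).1 hS.isUnit)
    ((Matrix.isUnit_iff_isUnit_det _).1 hR.isUnit))]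
  rw [Matrix.mul_neg, Matrix.neg_mul, Matrix.mul_assoc (A⁻¹)ᴴ, ← Matrix.mul_assoc Aᴴ, hAH,
    Matrix.one_mul, Matrix.nonsing_inv_mul_cancel_right _ _ hA']
  abel

theorem exists_isGreatest_setEQ_neg_psd (hR : R.PosDef) (hH : H.PosSemidef) (hA : A.det ≠ 0)
    (hne : (setGE A B R H ∩ -psd n).Nonempty) :
    ∃ W, IsGreatest (setEQ A B R H ∩ -psd n) W := by
  obtain ⟨X₀, hX₀ge, hX₀⟩ := hne
  change (-X₀).PosSemidef at hX₀
  have hmono : ∀ V W : Matrix (Fin n) (Fin n) ℂ, 0 ≤ V → V ≤ W →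
      dualRiccati A B R H V ≤ dualRiccati A B R H W := fun V W hV hVW =>
    conjM_mono (schurMap_mono hR (posSemidef_inv_conj hH (Matrix.nonneg_iff_posSemidef.1 hV))
      (conjTranspose_mul_mul_mono _ (add_le_add_left hVW H)))
  have hpos : ∀ V : Matrix (Fin n) (Fin n) ℂ, 0 ≤ V → 0 ≤ dualRiccati A B R H V := fun V hV =>
    Matrix.nonneg_iff_posSemidef.2 (posSemidef_conjM (posSemidef_schurMap hR
      (posSemidef_inv_conj hH (Matrix.nonneg_iff_posSemidef.1 hV))))
  -- Applying the monotone dual operator to `-X₀ ≤ -𝓡(X₀)` undoes `𝓡` on the right.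
  have hsup : dualRiccati A B R H (-X₀) ≤ -X₀ := by
    refine (hmono _ _ (Matrix.nonneg_iff_posSemidef.2 hX₀) (neg_le_neg hX₀ge.2)).trans_eq ?_
    exact dualRiccati_neg_riccati hR hA (setGE_subset_setP A B hR hH hX₀ge)
  obtain ⟨L, hL, hfix, hleast⟩ := exists_least_fixedPoint (dualRiccati A B R H) hmono hpos
    (fun V hV => by
      have h1 : Continuous fun V : Matrix (Fin n) (Fin n) ℂ => (A⁻¹)ᴴ * (V + H) * A⁻¹ :=
        (continuous_const.mul (continuous_id.add continuous_const)).mul continuous_const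
      have h2 := posDef_add_of_posSemidef (B := B) hR
        (posSemidef_inv_conj (A := A) hH (Matrix.nonneg_iff_posSemidef.1 hV))
      exact continuous_conjM.continuousAt.comp (continuousAt_schurMap_comp h1.continuousAt
        ((Matrix.isUnit_iff_isUnit_det _).1 h2.isUnit).ne_zero))
    (Matrix.nonneg_iff_posSemidef.2 hX₀) hsup
  have hL' := Matrix.nonneg_iff_posSemidef.1 hL
  refine ⟨-L, ⟨(mem_setEQ_of_dualRiccati_eq hR hH hA hL' hfix).1, ?_⟩, fun X hX => ?_⟩
  · change (- -L).PosSemidef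
    rwa [neg_neg]
  · have hXP := setGE_subset_setP A B hR hH ⟨hX.1.1, hX.1.2.symm.le⟩
    have h := dualRiccati_neg_riccati (H := H) hR hA hXP
    rw [← hX.1.2] at h
    exact le_neg_of_le_neg (hleast (-X) (Matrix.nonneg_iff_posSemidef.2 hX.2) h.le)

/-- When `H > 0`, a negative semidefinite solution is dominated by every solution in `ℙ`. -/
theorem le_of_mem_setEQ_neg_psd (hR : R.PosDef) (hH : H.PosDef) (hA : A.det ≠ 0)
    {W : Matrix (Fin n) (Fin n) ℂ} (hW : W ∈ setEQ A B R H ∩ -psd n)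
    (hX : X ∈ setEQ A B R H ∩ setP B R) : W ≤ X := by
  have hWpos : (-W).PosSemidef := hW.2
  have hWP := setGE_subset_setP A B hR hH.posSemidef ⟨hW.1.1, hW.1.2.symm.le⟩
  have hWfix := dualRiccati_neg_riccati (H := H) hR hA hWP
  have hXfix := dualRiccati_neg_riccati (H := H) hR hA hX.2
  have hXV := inv_conj_sub_riccati (B := B) (R := R) (H := H) hA X
  rw [← hW.1.2] at hWfix
  rw [← hX.1.2] at hXfix hXV
  have hXH : X.IsHermitian := hX.1.1.1
  obtain ⟨L, hL1, hL2⟩ := exists_contraction (B := B)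
    (U := (A⁻¹)ᴴ * (-X + H) * A⁻¹) (V := (A⁻¹)ᴴ * (-W + H) * A⁻¹) hR
    (Matrix.isHermitian_conjTranspose_mul_mul _ (hXH.neg.add hH.isHermitian))
    (posSemidef_inv_conj hH.posSemidef hWpos).isHermitian
    (by rw [hXV]; exact posDef_add_neg_schurMap hR hX.2.2)
    (posDef_add_of_posSemidef hR (posSemidef_inv_conj hH.posSemidef hWpos))
  have hUV : (A⁻¹)ᴴ * (-X + H) * A⁻¹ - (A⁻¹)ᴴ * (-W + H) * A⁻¹ = (A⁻¹)ᴴ * (W - X) * A⁻¹ := by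
    rw [← Matrix.sub_mul, ← Matrix.mul_sub]
    congr 2
    abel
  rw [hUV] at hL1
  have hLW : conjM (Lᴴ * ((A⁻¹)ᴴ * (-W + H) * A⁻¹) * L) ≤ -W :=
    (conjM_mono hL2).trans hWfix.le
  have hLX : W - X ≤ conjM (Lᴴ * ((A⁻¹)ᴴ * (W - X) * A⁻¹) * L) := by
    refine le_trans (le_of_eq ?_) (conjM_mono hL1)
    rw [conjM_sub]
    change W - X = dualRiccati A B R H (-X) - dualRiccati A B R H (-W)
    rw [hXfix, hWfix]
    abel
  -- Here `Q = -W + H` because the positive map `D ↦ conjM (Lᴴ (A⁻¹)ᴴ D A⁻¹ L)` sends it below `-W =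
  -- Q - H`, by `hLW`.
  refine sub_nonpos.1 (nonpos_of_forall_le_smul_sub hH (Q := -W + H)
    (le_add_of_nonneg_left (Matrix.nonneg_iff_posSemidef.2 hWpos))
    (hW.1.1.1.sub hXH) fun t ht hD => ?_)
  refine hLX.trans ((conjM_mono (conjTranspose_mul_mul_mono L
    (conjTranspose_mul_mul_mono A⁻¹ hD))).trans ?_)
  rw [add_sub_cancel_right]
  simpa only [Matrix.mul_smul, Matrix.smul_mul, conjM_real_smul] using
    smul_le_smul_of_nonneg_left hLW ht

end Dual

end CDARE

/-! ### Assembly of the statements. -/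

theorem mainTheorem5 {n m : ℕ} (hm : 0 < m)
    (A : Matrix (Fin n) (Fin n) ℂ) (B : Matrix (Fin n) (Fin m) ℂ)
    (R : Matrix (Fin m) (Fin m) ℂ) (H : Matrix (Fin n) (Fin n) ℂ)
    (hR : R.PosDef) (hH : H.PosSemidef) :
    (CDARE.setLE A B R H ∩ CDARE.setP B R).Nonempty ∧
    CDARE.setGE A B R H ⊆ CDARE.setP B R ∧
    ((CDARE.setGE A B R H ∩ CDARE.psd n).Nonempty →
      ∃ Zm, IsLeast (CDARE.setEQ A B R H ∩ CDARE.psd n) Zm) ∧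
    (A.det ≠ 0 → (CDARE.setGE A B R H ∩ -CDARE.psd n).Nonempty →
      ∃ WM, IsGreatest (CDARE.setEQ A B R H ∩ -CDARE.psd n) WM) ∧
    (H.PosDef → A.det ≠ 0 →
      ((CDARE.setGE A B R H ∩ CDARE.psd n).Nonempty →
        ∃ Zm ZM XM, IsLeast (CDARE.setEQ A B R H ∩ CDARE.psd n) Zm ∧
          IsGreatest (CDARE.setEQ A B R H ∩ CDARE.psd n) ZM ∧
          IsGreatest (CDARE.setEQ A B R H ∩ CDARE.setP B R) XM ∧
          0 ≤ Zm ∧ Zm ≤ ZM ∧ ZM = XM) ∧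
      ((CDARE.setGE A B R H ∩ -CDARE.psd n).Nonempty →
        ∃ Xm Wm WM, IsLeast (CDARE.setEQ A B R H ∩ CDARE.setP B R) Xm ∧
          IsLeast (CDARE.setEQ A B R H ∩ -CDARE.psd n) Wm ∧
          IsGreatest (CDARE.setEQ A B R H ∩ -CDARE.psd n) WM ∧
          Xm = Wm ∧ Wm ≤ WM ∧ WM ≤ 0) ∧
      ((CDARE.setGE A B R H ∩ CDARE.psd n).Nonempty →
        (CDARE.setGE A B R H ∩ -CDARE.psd n).Nonempty →
        ∃ Xm Wm WM Zm ZM XM,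
          IsLeast (CDARE.setEQ A B R H ∩ CDARE.setP B R) Xm ∧
          IsLeast (CDARE.setEQ A B R H ∩ -CDARE.psd n) Wm ∧
          IsGreatest (CDARE.setEQ A B R H ∩ -CDARE.psd n) WM ∧
          IsLeast (CDARE.setEQ A B R H ∩ CDARE.psd n) Zm ∧
          IsGreatest (CDARE.setEQ A B R H ∩ CDARE.psd n) ZM ∧
          IsGreatest (CDARE.setEQ A B R H ∩ CDARE.setP B R) XM ∧
          Xm = Wm ∧ Wm ≤ WM ∧ WM ≤ 0 ∧ 0 ≤ Zm ∧ Zm ≤ ZM ∧ ZM = XM)) ∧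
    (¬ ∃ YM, IsGreatest (CDARE.setEQ A B R H ∩ CDARE.setE B R) YM) ∧
    (¬ ∃ Ym, IsLeast (CDARE.setEQ A B R H ∩ CDARE.setE B R) Ym) := by
  have hP := CDARE.setGE_subset_setP A B hR hH
  have hEQP : CDARE.setEQ A B R H ⊆ CDARE.setP B R := fun X hX => hP ⟨hX.1, hX.2.symm.le⟩
  have hE : ∀ X, X ∉ CDARE.setEQ A B R H ∩ CDARE.setE B R := fun X hX =>
    Set.disjoint_left.1 (CDARE.disjoint_setP_setE hm B R) (hEQP hX.1) hX.2
  have hupper : H.PosDef → (CDARE.setGE A B R H ∩ CDARE.psd n).Nonempty →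
      ∃ Z, IsLeast (CDARE.setEQ A B R H ∩ CDARE.psd n) Z ∧
        IsGreatest (CDARE.setEQ A B R H ∩ CDARE.psd n) Z ∧
        IsGreatest (CDARE.setEQ A B R H ∩ CDARE.setP B R) Z ∧ 0 ≤ Z := by
    intro hH' hne
    obtain ⟨Z, hZ⟩ := CDARE.exists_isLeast_setEQ_psd hR hH hne
    -- The least positive semidefinite solution already dominates every solution, so one matrix
    -- serves as `Zm`, `ZM` and `XM`.
    have hmax : ∀ X ∈ CDARE.setEQ A B R H, X ≤ Z := fun X hX =>
      CDARE.le_of_mem_setEQ_psd hR hH' hZ.1 ⟨hX, hEQP hX⟩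
    exact ⟨Z, hZ, ⟨hZ.1, fun X hX => hmax X hX.1⟩,
      ⟨⟨hZ.1.1, hEQP hZ.1.1⟩, fun X hX => hmax X hX.1⟩, Matrix.nonneg_iff_posSemidef.2 hZ.1.2⟩
  have hlower : H.PosDef → A.det ≠ 0 → (CDARE.setGE A B R H ∩ -CDARE.psd n).Nonempty →
      ∃ W, IsLeast (CDARE.setEQ A B R H ∩ CDARE.setP B R) W ∧
        IsLeast (CDARE.setEQ A B R H ∩ -CDARE.psd n) W ∧
        IsGreatest (CDARE.setEQ A B R H ∩ -CDARE.psd n) W ∧ W ≤ 0 := by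
    intro hH' hA hne
    obtain ⟨W, hW⟩ := CDARE.exists_isGreatest_setEQ_neg_psd hR hH hA hne
    have hmin : ∀ X ∈ CDARE.setEQ A B R H, W ≤ X := fun X hX =>
      CDARE.le_of_mem_setEQ_neg_psd hR hH' hA hW.1 ⟨hX, hEQP hX⟩
    exact ⟨W, ⟨⟨hW.1.1, hEQP hW.1.1⟩, fun X hX => hmin X hX.1⟩, ⟨hW.1, fun X hX => hmin X hX.1⟩,
      hW, neg_nonneg.1 (Matrix.nonneg_iff_posSemidef.2 hW.1.2)⟩
  have hzero := CDARE.mem_setP_of_posSemidef (B := B) hR (.zero : (0 : Matrix _ _ ℂ).PosSemidef)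
  refine ⟨⟨0, ⟨hzero.1, ?_⟩, hzero⟩, hP, CDARE.exists_isLeast_setEQ_psd hR hH,
    CDARE.exists_isGreatest_setEQ_neg_psd hR hH, fun hH' hA => ⟨fun hne => ?_, fun hne => ?_,
    fun hne hne' => ?_⟩, fun ⟨Y, hY⟩ => hE Y hY.1, fun ⟨Y, hY⟩ => hE Y hY.1⟩
  -- The witness `0` works because `𝓡(0) = H ≥ 0`.
  · simpa [CDARE.riccati_eq_schurMap] using Matrix.nonneg_iff_posSemidef.2 hH
  · obtain ⟨Z, h1, h2, h3, h4⟩ := hupper hH' hne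
    exact ⟨Z, Z, Z, h1, h2, h3, h4, le_rfl, rfl⟩
  · obtain ⟨W, h1, h2, h3, h4⟩ := hlower hH' hA hne
    exact ⟨W, W, W, h1, h2, h3, rfl, le_rfl, h4⟩
  · obtain ⟨Z, h1, h2, h3, h4⟩ := hupper hH' hne
    obtain ⟨W, k1, k2, k3, k4⟩ := hlower hH' hA hne'
    exact ⟨W, W, W, Z, Z, Z, k1, k2, k3, h1, h2, h3, rfl, le_rfl, k4, h4, le_rfl, rfl⟩
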